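/- A $d$-polytope is a polytope (the convex hull of finitely many points in some $\mathbb{R}^n$) whose affine hull has dimension $d$. A polytope $P$ is called edge-antipodal if for any two vertices $x$ and $y$ of $P$ that are joined by an edge of $P$ there exist two distinct parallel hyperplanes, one through $x$ and one through $y$, such that $P$ is contained in the closed slab bounded by the two hyperplanes. **Theorem 1.** Let $d\geq 2$. Then the number of vertices of an edge-antipodal $d$-polytope is at most $\left(\frac{d}{2}+1\right)^d$. -/

import Mathlib

/-- `P` is a polytope of dimension `d`: the convex hull of finitely many points, with affine hull of
dimension `d`. -/
def IsDPolytope {E : Type*} [AddCommGroup E] [Module ℝ E] (d : ℕ) (P : Set E) : Prop :=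
  (∃ S : Finset E, P = convexHull ℝ (S : Set E)) ∧ Module.finrank ℝ (vectorSpan ℝ P) = d

/-- The vertices of a polytope are its extreme points. -/
def polytopeVertices {E : Type*} [AddCommGroup E] [Module ℝ E] (P : Set E) : Set E :=
  P.extremePoints ℝ

/-- The vertices `x` and `y` of `P` are joined by an edge: they are distinct, and the segment
between them is a face of `P`, that is, the set of maximizers over `P` of a linear functional. -/
def JoinedByEdge {E : Type*} [AddCommGroup E] [Module ℝ E] [TopologicalSpace E]
    (P : Set E) (x y : E) : Prop :=
  x ∈ polytopeVertices P ∧ y ∈ polytopeVertices P ∧ x ≠ y ∧ IsExposed ℝ P (segment ℝ x y)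

/-- There are two (distinct) parallel hyperplanes `{p | l p = l x}` and `{p | l p = l y}`, one
through `x` and one through `y`, such that `P` lies in the closed slab bounded by them. -/
def InSlabBetween {E : Type*} [AddCommGroup E] [Module ℝ E] [TopologicalSpace E]
    (P : Set E) (x y : E) : Prop :=
  ∃ l : StrongDual ℝ E, l x < l y ∧ ∀ p ∈ P, l x ≤ l p ∧ l p ≤ l y

/-- Any two vertices of `P` that are joined by an edge lie on two parallel hyperplanes bounding a
closed slab that contains `P`. -/
def IsEdgeAntipodal {E : Type*} [AddCommGroup E] [Module ℝ E] [TopologicalSpace E]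
    (P : Set E) : Prop :=
  ∀ x y : E, JoinedByEdge P x y → InSlabBetween P x y

/-!
Put `N` for the number of vertices of `P` and shrink `P` towards each of its vertices by a factor
`c < 2 / (d + 2)`. All `N` copies lie in `P`, and they turn out to be pairwise disjoint, so comparing
volumes in the `d`-dimensional affine hull gives `N * c ^ d ≤ 1`; now let `c` tend to `2 / (d + 2)`.

If the copies at two vertices `x`, `y` met, then `y - x = r • (p - q)` with `p, q ∈ P` and
`r = c / (1 - c) < 2 / d`. So the point is that `r ≥ 2 / d` whenever `y - x ∈ r • (P - P)`
(`two_le_finrank_mul`). In other words, distinct vertices are at distance at least `2 / d` in the norm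
with unit ball `P - P`, in which edge-antipodality says that every edge is as long as the diameter.

If `xy` is an edge, then the slab of that edge gives `r ≥ 1`. Otherwise follow the segment from `x` to
`y` until it first meets the convex hull of the vertices other than `x`, at `z = x + s • (y - x)`.
Minimality of `s` forces `z` to be a convex combination of at most `d` neighbours of `x`
(`exists_least_convexComb_neighbours`): a vertex `v` that is not a neighbour could be replaced by a
point of the hull on the open segment `xv` (`joinedByEdge_or_exists_mem_convexHull`), which would give
a point of the hull before `z`. The slab of each edge `x v i` bounds the weight of `v i` by `s * r`, so
`1 ≤ d * s * r` (`one_le_mul_of_convexComb_neighbours`). From `y` one gets likewise a point `y + t • (x - y)` with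
`1 ≤ d * t * r`, in the hull of the neighbours of `y`. None of these is `x`, so this point is not before
`z`, that is `s + t ≤ 1`. Adding up, `2 ≤ d * r`.
-/

/-! ### Vertices and edges of a polytope -/

section
variable {E : Type*} [AddCommGroup E] [Module ℝ E]

/-- A conic combination of vectors `b i - x` with `b i` in a convex set `Q` points from `x` to a point
of `Q`, reached on dividing by the total weight. -/
theorem Convex.add_inv_smul_sum_mem {Q : Set E} (hQ : Convex ℝ Q) {ι : Type*} [Fintype ι]
    {a : ι → ℝ} {b : ι → E} (x : E) (ha : ∀ i, 0 ≤ a i) (hpos : 0 < ∑ i, a i)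
    (hb : ∀ i, b i ∈ Q) : x + (∑ i, a i)⁻¹ • ∑ i, a i • (b i - x) ∈ Q := by
  have h := hQ.centerMass_mem (t := Finset.univ) (fun i _ => ha i) hpos (fun i _ => hb i)
  convert h using 1
  rw [Finset.centerMass]
  simp only [smul_sub, Finset.sum_sub_distrib, ← Finset.sum_smul]
  rw [inv_smul_smul₀ hpos.ne']
  abel

theorem notMem_convexHull_vertices_sdiff {P : Set E} (hconv : Convex ℝ P) {x : E}
    (hx : x ∈ polytopeVertices P) : x ∉ convexHull ℝ (polytopeVertices P \ {x}) := by
  intro h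
  have hc := (hconv.mem_extremePoints_iff_convex_sdiff.1 hx).2
  exact (convexHull_min (Set.sdiff_subset_sdiff_left extremePoints_subset) hc h).2 rfl
end

section
variable {E : Type*} [NormedAddCommGroup E] [NormedSpace ℝ E] {P : Set E}

/-- Every vertex of a polytope is exposed. -/
theorem exists_forall_lt_of_mem_vertices (hV : (polytopeVertices P).Finite) (hconv : Convex ℝ P)
    {x : E} (hx : x ∈ polytopeVertices P) :
    ∃ g : StrongDual ℝ E, ∀ w ∈ polytopeVertices P, w ≠ x → g x < g w := by
  obtain ⟨g, u, h1, h2⟩ := geometric_hahn_banach_point_closed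
    (convex_convexHull ℝ (polytopeVertices P \ {x})) ((hV.sdiff).isClosed_convexHull ℝ)
    (notMem_convexHull_vertices_sdiff hconv hx)
  exact ⟨g, fun w hw hwx => h1.trans (h2 w (subset_convexHull ℝ _ ⟨hw, hwx⟩))⟩

/-- Two vertices at which a linear functional attains its minimum over the vertices, and which are the
only ones where it does, are joined by an edge. -/
theorem joinedByEdge_of_forall_lt (hPc : IsCompact P) (hconv : Convex ℝ P) {x v : E}
    (hx : x ∈ polytopeVertices P) (hv : v ∈ polytopeVertices P) (hxv : x ≠ v)
    (F : StrongDual ℝ E) (hF : F v = F x)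
    (hlt : ∀ w ∈ polytopeVertices P, w ≠ x → w ≠ v → F x < F w) : JoinedByEdge P x v := by
  refine ⟨hx, hv, hxv, ?_⟩
  have hexp : IsExposed ℝ P ((-F).toExposed P) := ContinuousLinearMap.toExposed.isExposed
  have hmin : ∀ q ∈ P, F x ≤ F q := by
    intro q hq
    rw [← closure_convexHull_extremePoints hPc hconv] at hq
    have : closure (convexHull ℝ (P.extremePoints ℝ)) ⊆ {p | F x ≤ F p} := by
      refine closure_minimal (convexHull_min ?_ (convex_halfSpace_ge F.isLinear _))
        (isClosed_le continuous_const F.continuous)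
      intro w hw
      by_cases h1 : w = x
      · simp [h1]
      by_cases h2 : w = v
      · simp [h2, hF]
      exact (hlt w hw h1 h2).le
    exact this hq
  suffices h : segment ℝ x v = (-F).toExposed P by rw [h]; exact hexp
  apply Set.Subset.antisymm
  · refine (hexp.convex hconv).segment_subset ⟨extremePoints_subset hx, fun q hq => ?_⟩
      ⟨extremePoints_subset hv, fun q hq => ?_⟩
    · simpa using hmin q hq
    · simpa [hF] using hmin q hq
  · rw [← closure_convexHull_extremePoints (hexp.isCompact hPc) (hexp.convex hconv)]
    have hsub : convexHull ℝ (((-F).toExposed P).extremePoints ℝ) ⊆ segment ℝ x v := by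
      rw [← convexHull_pair]
      refine convexHull_mono fun w hw => ?_
      have hwV := hexp.isExtreme.extremePoints_subset_extremePoints hw
      by_contra hne
      rw [Set.mem_insert_iff, Set.mem_singleton_iff, not_or] at hne
      have h1 := hlt w hwV hne.1 hne.2
      have h2 := (extremePoints_subset hw).2 x (extremePoints_subset hx)
      simp only [neg_apply, neg_le_neg_iff] at h2
      exact absurd h1 h2.not_gt
    refine closure_minimal hsub ?_
    rw [← convexHull_pair]
    exact (Set.toFinite _).isClosed_convexHull ℝ

/-- If two vertices `x`, `v` are not joined by an edge, then the open segment between them contains a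
point of the convex hull of the vertices other than `x`. Indeed, `v - x` is then in the cone generated
by the other vectors `w - x`; otherwise the two would be separated, in the vertex figure at `x`, by a
functional that exposes the segment. -/
theorem joinedByEdge_or_exists_mem_convexHull (hV : (polytopeVertices P).Finite)
    (hPc : IsCompact P) (hconv : Convex ℝ P) {x v : E} (hx : x ∈ polytopeVertices P)
    (hv : v ∈ polytopeVertices P) (hxv : x ≠ v) :
    JoinedByEdge P x v ∨
      ∃ c : ℝ, 1 < c ∧ x + c⁻¹ • (v - x) ∈ convexHull ℝ (polytopeVertices P \ {x}) := by
  obtain ⟨g, hg⟩ := exists_forall_lt_of_mem_vertices hV hconv hx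
  have hg' : ∀ w ∈ polytopeVertices P, w ≠ x → 0 < g (w - x) := fun w hw hwx => by
    rw [map_sub]; linarith [hg w hw hwx]
  have hgv := hg' v hv hxv.symm
  -- The radial projection of `w - x` to the hyperplane `g = 1`, which makes the vertex figure compact.
  let ρ : E → E := fun w => (g (w - x))⁻¹ • (w - x)
  by_cases hK : ρ v ∈ convexHull ℝ (ρ '' (polytopeVertices P \ {x, v}))
  · right
    obtain ⟨ι, _, κ, z, hκ0, hκ1, hz, hsum⟩ := mem_convexHull_iff_exists_fintype.1 hK
    choose y hy hyz using hz
    have hyV : ∀ i, y i ∈ polytopeVertices P := fun i => (hy i).1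
    have hyx : ∀ i, y i ≠ x := fun i h => (hy i).2 (by simp [h])
    have hyv : ∀ i, y i ≠ v := fun i h => (hy i).2 (by simp [h])
    let c : ι → ℝ := fun i => g (v - x) * (κ i * (g (y i - x))⁻¹)
    have hc0 : ∀ i, 0 ≤ c i := fun i =>
      mul_nonneg hgv.le (mul_nonneg (hκ0 i) (inv_nonneg.2 (hg' _ (hyV i) (hyx i)).le))
    have hrep : ∑ i, c i • (y i - x) = v - x := by
      have : ∑ i, c i • (y i - x) = g (v - x) • ∑ i, κ i • z i := by
        rw [Finset.smul_sum]
        refine Finset.sum_congr rfl fun i _ => ?_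
        simp only [c, ρ, ← hyz, smul_smul]
      rw [this, hsum]
      exact smul_inv_smul₀ hgv.ne' _
    have hCpos : 0 < ∑ i, c i := by
      refine lt_of_le_of_ne (Finset.sum_nonneg fun i _ => hc0 i) fun h => hxv ?_
      have h0 := (Finset.sum_eq_zero_iff_of_nonneg fun i _ => hc0 i).1 h.symm
      rw [Finset.sum_eq_zero fun i hi => by rw [h0 i hi, zero_smul]] at hrep
      exact (sub_eq_zero.1 hrep.symm).symm
    refine ⟨∑ i, c i, ?_, ?_⟩
    · -- If the total weight were at most one, `v` would be a convex combination of other vertices.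
      by_contra hC
      rw [not_lt] at hC
      have hm := (convex_convexHull ℝ (polytopeVertices P \ {v})).add_inv_smul_sum_mem x hc0 hCpos
        (fun i => subset_convexHull ℝ _ ⟨hyV i, hyv i⟩)
      rw [hrep] at hm
      have hxm := subset_convexHull ℝ (polytopeVertices P \ {v}) ⟨hx, hxv⟩
      have := (convex_convexHull ℝ (polytopeVertices P \ {v})).add_smul_mem hxm hm ⟨hCpos.le, hC⟩
      rw [smul_inv_smul₀ hCpos.ne', add_sub_cancel] at this
      exact notMem_convexHull_vertices_sdiff hconv hv this
    · have hm := (convex_convexHull ℝ (polytopeVertices P \ {x})).add_inv_smul_sum_mem x hc0 hCpos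
        (fun i => subset_convexHull ℝ _ ⟨hyV i, hyx i⟩)
      rwa [hrep] at hm
  · left
    obtain ⟨f, u, h1, h2⟩ := geometric_hahn_banach_point_closed (convex_convexHull ℝ _)
      (((hV.sdiff).image ρ).isClosed_convexHull ℝ) hK
    have key : ∀ w ∈ polytopeVertices P, w ≠ x → f (w - x) = g (w - x) * f (ρ w) :=
      fun w hw hwx => by
        simp only [ρ, map_smul, smul_eq_mul]
        rw [mul_inv_cancel_left₀ (hg' w hw hwx).ne']
    -- The functional vanishes at `v - x` and is positive at the other `w - x`.
    refine joinedByEdge_of_forall_lt hPc hconv hx hv hxv (f - f (ρ v) • g) ?_ ?_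
    · have := key v hv hxv.symm
      simp only [map_sub] at this
      simp only [sub_apply, smul_apply, smul_eq_mul]
      linarith
    · intro w hw hwx hwv
      have h3 := key w hw hwx
      have h4 : f (ρ v) < f (ρ w) :=
        h1.trans (h2 _ (subset_convexHull ℝ _ ⟨w, ⟨hw, by simp [hwx, hwv]⟩, rfl⟩))
      have h5 := mul_lt_mul_of_pos_left h4 (hg' w hw hwx)
      simp only [map_sub] at h3 h5
      simp only [sub_apply, smul_apply, smul_eq_mul]
      linarith
end

/-! ### The distance between two vertices -/

section
universe u

variable {E : Type u} [NormedAddCommGroup E] [NormedSpace ℝ E] {P : Set E}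

/-- The first point `x + s • (y - x)`, on the way from a vertex `x` to a vertex `y`, of the convex hull of
the vertices other than `x` is a convex combination of neighbours of `x`, no more of them than the
dimension of `P`. -/
theorem exists_least_convexComb_neighbours [FiniteDimensional ℝ E] (hV : (polytopeVertices P).Finite)
    (hPc : IsCompact P) (hconv : Convex ℝ P) {x y : E} (hx : x ∈ polytopeVertices P)
    (hy : y ∈ polytopeVertices P) (hxy : x ≠ y) :
    ∃ (s : ℝ) (ι : Type u) (_ : Fintype ι) (v : ι → E) (a : ι → ℝ),
      0 < s ∧ s ≤ 1 ∧
      (∀ t, 0 ≤ t → x + t • (y - x) ∈ convexHull ℝ (polytopeVertices P \ {x}) → s ≤ t) ∧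
      Fintype.card ι ≤ Module.finrank ℝ (vectorSpan ℝ P) ∧
      (∀ i, JoinedByEdge P x (v i)) ∧ (∀ i, 0 ≤ a i) ∧ ∑ i, a i = 1 ∧
      ∑ i, a i • v i = x + s • (y - x) := by
  classical
  set Q := convexHull ℝ (polytopeVertices P \ {x}) with hQ
  have hQconv : Convex ℝ Q := convex_convexHull ℝ _
  have hQclosed : IsClosed Q := hV.sdiff.isClosed_convexHull ℝ
  have hxQ : x ∉ Q := notMem_convexHull_vertices_sdiff hconv hx
  have hyQ : y ∈ Q := subset_convexHull ℝ _ ⟨hy, hxy.symm⟩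
  obtain ⟨s, ⟨⟨hs0, hs1⟩, hsQ⟩, hsl⟩ :=
    (isCompact_Icc.inter_right (hQclosed.preimage
      (by fun_prop : Continuous fun t : ℝ => x + t • (y - x)))).exists_isLeast
      (s := Set.Icc (0 : ℝ) 1 ∩ (fun t : ℝ => x + t • (y - x)) ⁻¹' Q)
      ⟨1, ⟨zero_le_one, le_rfl⟩, by simpa using hyQ⟩
  have hmin : ∀ t, 0 ≤ t → x + t • (y - x) ∈ Q → s ≤ t := by
    intro t ht htQ
    rcases le_total t 1 with h | h
    · exact hsl ⟨⟨ht, h⟩, htQ⟩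
    · exact hs1.trans h
  have hspos : 0 < s := by
    refine lt_of_le_of_ne hs0 fun h => hxQ ?_
    have : x + s • (y - x) ∈ Q := hsQ
    rwa [← h, zero_smul, add_zero] at this
  obtain ⟨ι, _, v, a, hvr, hind, hapos, ha1, hav⟩ := eq_pos_convex_span_of_mem_convexHull hsQ
  have hvV : ∀ i, v i ∈ polytopeVertices P \ {x} := fun i => hvr ⟨i, rfl⟩
  have hvQ : ∀ i, v i ∈ Q := fun i => subset_convexHull ℝ _ (hvV i)
  have hcone : ∑ i, a i • (v i - x) = s • (y - x) := by
    simp only [smul_sub, Finset.sum_sub_distrib, ← Finset.sum_smul, ha1, hav, one_smul]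
    simp
  -- A conic combination of weight above one would yield a point of `Q` before the first one.
  have hle : ∀ (b : ι → ℝ) (u : ι → E), (∀ i, 0 ≤ b i) → (∀ i, u i ∈ Q) →
      ∑ i, b i • (u i - x) = s • (y - x) → ∑ i, b i ≤ 1 := by
    intro b u hb hu hsum
    by_contra hlt
    rw [not_le] at hlt
    have hm := hQconv.add_inv_smul_sum_mem x hb (by linarith) hu
    rw [hsum, smul_smul] at hm
    have h1 := hmin _ (by have := inv_nonneg.2 (zero_le_one.trans hlt.le); positivity) hm
    have h2 : (∑ i, b i)⁻¹ < 1 := inv_lt_one_of_one_lt₀ hlt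
    nlinarith
  -- Otherwise `0 = ∑ i, μ i • (v i - x)` with `∑ i, μ i = 1`, and adding a small multiple of `μ` to the
  -- positive weights `a` would raise their sum.
  have hspan : x ∉ affineSpan ℝ (Set.range v) := by
    intro hmem
    obtain ⟨μ, hμ1, hμ⟩ := eq_affineCombination_of_mem_affineSpan_of_fintype hmem
    rw [Finset.affineCombination_eq_linear_combination _ _ _ hμ1] at hμ
    have hμ0 : ∑ i, μ i • (v i - x) = 0 := by
      simp only [smul_sub, Finset.sum_sub_distrib, ← Finset.sum_smul, hμ1, one_smul, ← hμ, sub_self]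
    have hev : ∀ᶠ ε in nhdsWithin (0 : ℝ) (Set.Ioi 0), ∀ i, 0 ≤ a i + ε * μ i := by
      rw [Filter.eventually_all]
      intro i
      have hc : Filter.Tendsto (fun ε : ℝ => a i + ε * μ i) (nhdsWithin 0 (Set.Ioi 0))
          (nhds (a i + 0 * μ i)) :=
        (Continuous.tendsto (by fun_prop) 0).mono_left nhdsWithin_le_nhds
      rw [zero_mul, add_zero] at hc
      exact (hc.eventually (lt_mem_nhds (hapos i))).mono fun _ h => h.le
    obtain ⟨ε, hε, hε0⟩ := (hev.and self_mem_nhdsWithin).exists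
    replace hε0 : 0 < ε := hε0
    have := hle (fun i => a i + ε * μ i) v hε hvQ (by
      simp only [add_smul, mul_smul, Finset.sum_add_distrib, ← Finset.smul_sum, hμ0, hcone,
        smul_zero, add_zero])
    rw [Finset.sum_add_distrib, ← Finset.mul_sum, ha1, hμ1] at this
    linarith
  have hne : Nonempty ι := by
    by_contra h
    rw [not_nonempty_iff] at h
    simp at ha1
  obtain ⟨i₀⟩ := hne
  refine ⟨s, ι, inferInstance, v, a, hspos, hs1, hmin, ?_, fun i => ?_, fun i => (hapos i).le,
    ha1, hav⟩
  · have hlt : vectorSpan ℝ (Set.range v) < vectorSpan ℝ P := by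
      refine lt_of_le_of_ne (vectorSpan_mono ℝ ?_) fun h => hspan ?_
      · rintro _ ⟨i, rfl⟩
        exact extremePoints_subset (hvV i).1
      · have h1 : x -ᵥ v i₀ ∈ vectorSpan ℝ P :=
          vsub_mem_vectorSpan ℝ (extremePoints_subset hx) (extremePoints_subset (hvV i₀).1)
        rw [← h, ← direction_affineSpan] at h1
        have := AffineSubspace.vadd_mem_of_mem_direction h1
          (mem_affineSpan ℝ (Set.mem_range_self i₀))
        rwa [vsub_vadd] at this
    have h1 := hind.card_le_finrank_succ
    have h2 := Submodule.finrank_lt_finrank_of_lt hlt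
    omega
  · rcases joinedByEdge_or_exists_mem_convexHull hV hPc hconv hx (hvV i).1
      (fun h => (hvV i).2 h.symm) with h | ⟨c, hc, hcQ⟩
    · exact h
    -- Use the point of `Q` on the open segment from `x` to `v i`, with weight `c * a i`, for `v i`.
    exfalso
    have := hle (fun j => if j = i then c * a j else a j)
      (fun j => if j = i then x + c⁻¹ • (v i - x) else v j)
      (fun j => by
        have := (hapos j).le
        split_ifs <;> positivity)
      (fun j => by
        split_ifs
        exacts [hcQ, hvQ j])
      (by
        rw [← hcone]
        refine Finset.sum_congr rfl fun j _ => ?_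
        by_cases hj : j = i
        · subst hj
          have hc0 : c ≠ 0 := by positivity
          simp only [if_true, add_sub_cancel_left, smul_smul]
          congr 1
          field_simp
        · simp [hj])
    have hlt : ∑ j, a j < ∑ j, (if j = i then c * a j else a j) := by
      refine Finset.sum_lt_sum (fun j _ => ?_) ⟨i, Finset.mem_univ _, ?_⟩
      · have := hapos j
        split_ifs <;> nlinarith
      · have := hapos i
        simp only [if_true]
        nlinarith
    linarith

/-- If `y - x ∈ r • (P - P)` and `x + s • (y - x)` is a convex combination of neighbours of `x`, then
each of its weights is at most `s * r`, by the slab of the corresponding edge. -/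
theorem one_le_mul_of_convexComb_neighbours {x y : E} (hanti : IsEdgeAntipodal P) {p q : E} (hp : p ∈ P)
    (hq : q ∈ P) {r : ℝ} (hr : 0 ≤ r) (hyx : y - x = r • (p - q)) {s : ℝ} (hs : 0 ≤ s)
    {ι : Type*} [Fintype ι] {v : ι → E} {a : ι → ℝ} {d : ℕ} (hcard : Fintype.card ι ≤ d)
    (hv : ∀ i, JoinedByEdge P x (v i)) (ha : ∀ i, 0 ≤ a i) (ha1 : ∑ i, a i = 1)
    (hav : ∑ i, a i • v i = x + s • (y - x)) : 1 ≤ d * (s * r) := by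
  have hcone : ∑ i, a i • (v i - x) = s • (y - x) := by
    simp only [smul_sub, Finset.sum_sub_distrib, ← Finset.sum_smul, ha1, hav, one_smul]
    simp
  have hcoef : ∀ i, a i ≤ s * r := by
    intro i
    obtain ⟨l, hl, hslab⟩ := hanti _ _ (hv i)
    have hpos : 0 < l (v i) - l x := sub_pos.2 hl
    have h1 : a i * (l (v i) - l x) ≤ s * (l y - l x) := by
      have := congrArg l hcone
      simp only [map_sum, map_smul, smul_eq_mul, map_sub] at this
      rw [← this]
      refine Finset.single_le_sum (f := fun i => a i * (l (v i) - l x)) (fun j _ => ?_)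
        (Finset.mem_univ i)
      exact mul_nonneg (ha j)
        (sub_nonneg.2 (hslab _ (extremePoints_subset (hv j).2.1)).1)
    have h2 : l y - l x ≤ r * (l (v i) - l x) := by
      have := congrArg l hyx
      simp only [map_smul, smul_eq_mul, map_sub] at this
      rw [this]
      exact mul_le_mul_of_nonneg_left (by linarith [(hslab p hp).2, (hslab q hq).1]) hr
    refine le_of_mul_le_mul_right ?_ hpos
    calc _ ≤ s * (l y - l x) := h1
      _ ≤ s * (r * (l (v i) - l x)) := mul_le_mul_of_nonneg_left h2 hs
      _ = _ := by ring
  calc (1 : ℝ) = ∑ i, a i := ha1.symm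
    _ ≤ ∑ _i : ι, s * r := Finset.sum_le_sum fun i _ => hcoef i
    _ = Fintype.card ι * (s * r) := by simp
    _ ≤ d * (s * r) := by gcongr

/-- In the norm with unit ball `P - P`, distinct vertices of an edge-antipodal `d`-polytope are at
distance at least `2 / d`. -/
theorem two_le_finrank_mul [FiniteDimensional ℝ E] (hV : (polytopeVertices P).Finite)
    (hPc : IsCompact P) (hconv : Convex ℝ P) (hanti : IsEdgeAntipodal P)
    (hd : 2 ≤ Module.finrank ℝ (vectorSpan ℝ P)) {x y : E} (hx : x ∈ polytopeVertices P)
    (hy : y ∈ polytopeVertices P) (hxy : x ≠ y) {p q : E} (hp : p ∈ P) (hq : q ∈ P) {r : ℝ}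
    (hr : 0 ≤ r) (hyx : y - x = r • (p - q)) : 2 ≤ Module.finrank ℝ (vectorSpan ℝ P) * r := by
  have hd' : (2 : ℝ) ≤ Module.finrank ℝ (vectorSpan ℝ P) := by exact_mod_cast hd
  by_cases hadj : JoinedByEdge P y x
  · obtain ⟨l, hl, hslab⟩ := hanti _ _ hadj
    have h1 := congrArg l hyx
    simp only [map_smul, smul_eq_mul, map_sub] at h1
    have h2 : r * (l q - l p) ≤ r * (l x - l y) :=
      mul_le_mul_of_nonneg_left (by linarith [(hslab q hq).2, (hslab p hp).1]) hr
    have h3 : 1 ≤ r := by nlinarith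
    nlinarith
  obtain ⟨s, ι, _, v, a, hs, -, hsmin, hcard, hv, ha, ha1, hav⟩ :=
    exists_least_convexComb_neighbours hV hPc hconv hx hy hxy
  obtain ⟨t, κ, _, u, b, ht, ht1, -, hcard', hu, hb, hb1, hbu⟩ :=
    exists_least_convexComb_neighbours hV hPc hconv hy hx hxy.symm
  have h1 := one_le_mul_of_convexComb_neighbours hanti hp hq hr hyx hs.le hcard hv ha ha1 hav
  have h2 := one_le_mul_of_convexComb_neighbours hanti hq hp hr
    (by rw [← neg_sub y x, hyx, ← smul_neg, neg_sub]) ht.le hcard' hu hb hb1 hbu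
  have hmem : y + t • (x - y) ∈ convexHull ℝ (polytopeVertices P \ {x}) := by
    rw [← hbu]
    exact (convex_convexHull ℝ _).sum_mem (fun i _ => hb i) hb1 fun i _ =>
      subset_convexHull ℝ _ ⟨(hu i).2.1, fun h => hadj (by
        rw [Set.mem_singleton_iff] at h
        exact h ▸ hu i)⟩
  -- The point found from `y` equals `x + (1 - t) • (y - x)`.
  have hst : s + t ≤ 1 := by
    have := hsmin (1 - t) (by linarith) (by
      convert hmem using 1
      module)
    linarith
  have hd0 : (0 : ℝ) ≤ Module.finrank ℝ (vectorSpan ℝ P) * r := by positivity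
  nlinarith [mul_le_mul_of_nonneg_left hst hd0]

end

/-! ### Comparison of volumes -/

section
open MeasureTheory

theorem card_mul_pow_finrank_le_one {W : Type*} [NormedAddCommGroup W] [NormedSpace ℝ W]
    [FiniteDimensional ℝ W] {S : Set W} (hS : Convex ℝ S) (hSc : IsCompact S)
    (hSi : (interior S).Nonempty) {V : Finset W} (hVS : (V : Set W) ⊆ S) {c : ℝ} (hc0 : 0 ≤ c)
    (hc1 : c ≤ 1)
    (hdisj : (V : Set W).PairwiseDisjoint fun x => AffineMap.homothety x c '' S) :
    (V.card : ℝ) * c ^ Module.finrank ℝ W ≤ 1 := by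
  borelize W
  let μ : Measure W := Measure.addHaar
  have hpos : μ S ≠ 0 :=
    ((isOpen_interior.measure_pos μ hSi).trans_le (measure_mono interior_subset)).ne'
  have hfin : μ S ≠ ⊤ := hSc.measure_lt_top.ne
  have hsub : (⋃ x ∈ V, AffineMap.homothety x c '' S) ⊆ S := by
    refine Set.iUnion₂_subset fun x hx => ?_
    rintro _ ⟨p, hp, rfl⟩
    rw [AffineMap.homothety_eq_lineMap]
    exact hS.lineMap_mem (hVS hx) hp ⟨hc0, hc1⟩
  have hmeas : ∀ x ∈ V, MeasurableSet (AffineMap.homothety x c '' S) := fun x _ =>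
    (hSc.image (AffineMap.continuous_of_finiteDimensional _)).measurableSet
  have h1 := measure_mono (μ := μ) hsub
  rw [measure_biUnion_finset hdisj hmeas] at h1
  simp only [Measure.addHaar_image_homothety, Finset.sum_const, nsmul_eq_mul] at h1
  rw [abs_of_nonneg (by positivity), ← mul_assoc] at h1
  have h2 : (V.card : ENNReal) * ENNReal.ofReal (c ^ Module.finrank ℝ W) ≤ 1 := by
    by_contra h
    rw [not_le] at h
    have := ENNReal.mul_lt_mul_left hpos hfin h
    rw [one_mul] at this
    exact absurd h1 this.not_ge
  rw [← ENNReal.ofReal_natCast, ← ENNReal.ofReal_mul (by positivity)] at h2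
  exact ENNReal.ofReal_le_one.1 h2
end

theorem theorem1 (d : ℕ) (hd : 2 ≤ d) (n : ℕ) (P : Set (EuclideanSpace ℝ (Fin n)))
    (hP : IsDPolytope d P) (hanti : IsEdgeAntipodal P) :
    (polytopeVertices P).Finite ∧
      ((polytopeVertices P).ncard : ℝ) ≤ ((d : ℝ) / 2 + 1) ^ d := by
  obtain ⟨⟨T, hT⟩, hdim⟩ := hP
  have hV : (polytopeVertices P).Finite := by
    rw [polytopeVertices, hT]
    exact T.finite_toSet.subset extremePoints_convexHull_subset
  have hconv : Convex ℝ P := hT ▸ convex_convexHull ℝ _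
  have hPc : IsCompact P := hT ▸ T.finite_toSet.isCompact_convexHull ℝ
  refine ⟨hV, ?_⟩
  have hne : P.Nonempty := by
    by_contra h
    rw [Set.not_nonempty_iff_eq_empty] at h
    rw [h, vectorSpan_empty, finrank_bot] at hdim
    omega
  obtain ⟨p₀, hp₀⟩ := hne
  -- Volumes are taken in the direction space of `P`, where the preimage `S` of `P` has interior points.
  let f : vectorSpan ℝ P →ᵃ[ℝ] EuclideanSpace ℝ (Fin n) :=
    (vectorSpan ℝ P).subtype.toAffineMap + AffineMap.const ℝ _ p₀
  have hf : ∀ w, f w = w + p₀ := fun w => rfl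
  have hfinj : Function.Injective f := fun a b hab => by
    rw [hf, hf, add_left_inj] at hab
    exact Subtype.ext hab
  have hrange : P ⊆ Set.range f := fun p hp =>
    ⟨⟨p - p₀, vsub_mem_vectorSpan ℝ hp hp₀⟩, by rw [hf]; simp⟩
  set S := f ⁻¹' P with hSdef
  have himage : f '' S = P := Set.image_preimage_eq_of_subset hrange
  have hSconv : Convex ℝ S := hconv.affine_preimage f
  have hSc : IsCompact S := by
    have hemb : Topology.IsClosedEmbedding f := by
      have h1 : Topology.IsClosedEmbedding ((↑) : vectorSpan ℝ P → EuclideanSpace ℝ (Fin n)) :=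
        (Submodule.closed_of_finiteDimensional _).isClosedEmbedding_subtypeVal
      exact (Homeomorph.addRight p₀).isClosedEmbedding.comp h1
    exact hemb.isCompact_preimage hPc
  have hSi : (interior S).Nonempty := by
    rw [hSconv.interior_nonempty_iff_affineSpan_eq_top]
    have hSne : S.Nonempty := ⟨0, by simpa [hSdef, hf] using hp₀⟩
    rw [AffineSubspace.affineSpan_eq_top_iff_vectorSpan_eq_top_of_nonempty ℝ _ _ hSne]
    have h1 := f.map_vectorSpan (s := S)
    have h2 : f.linear = (vectorSpan ℝ P).subtype := by ext; simp [f]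
    rw [himage, h2] at h1
    rw [Submodule.eq_top_iff']
    intro w
    obtain ⟨w', hw', h⟩ := h1.ge w.2
    rwa [← Subtype.ext (show (w' : EuclideanSpace ℝ (Fin n)) = w from h)]
  have hV' : (f ⁻¹' polytopeVertices P).Finite := hV.preimage hfinj.injOn
  have hcard : hV'.toFinset.card = (polytopeVertices P).ncard := by
    rw [← Set.ncard_eq_toFinset_card _ hV']
    exact Set.ncard_preimage_of_injective_subset_range hfinj (extremePoints_subset.trans hrange)
  have hdR : (2 : ℝ) ≤ d := by exact_mod_cast hd
  have hkey : ∀ c : ℝ, 0 ≤ c → c < 2 / (d + 2) →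
      ((polytopeVertices P).ncard : ℝ) * c ^ d ≤ 1 := by
    intro c hc0 hc
    rw [lt_div_iff₀ (by linarith)] at hc
    have hc1 : c < 1 := by nlinarith
    have := card_mul_pow_finrank_le_one hSconv hSc hSi (V := hV'.toFinset) (c := c)
      (fun x hx => show f x ∈ P from
        extremePoints_subset ((Set.Finite.mem_toFinset hV').1 (Finset.mem_coe.1 hx))) hc0 hc1.le ?_
    · rwa [hcard, hdim] at this
    intro x hx y hy hxy
    rw [Function.onFun, Set.disjoint_left]
    rintro _ ⟨p, hp, rfl⟩ ⟨q, hq, hpq⟩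
    have hx' : f x ∈ polytopeVertices P := (Set.Finite.mem_toFinset hV').1 hx
    have hy' : f y ∈ polytopeVertices P := (Set.Finite.mem_toFinset hV').1 hy
    have hrel : f y - f x = (c / (1 - c)) • (f p - f q) := by
      have h1 : y - x = (c / (1 - c)) • (p - q) := by
        simp only [AffineMap.homothety_apply, vsub_eq_sub, vadd_eq_add] at hpq
        have h2 : (1 - c) • (y - x) = c • (p - q) := by
          rw [← sub_eq_zero] at hpq ⊢
          rw [← hpq]
          module
        rw [div_eq_inv_mul, mul_smul, ← h2, inv_smul_smul₀ (by linarith)]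
      have h3 := congrArg (Subtype.val) h1
      simpa [hf] using h3
    have := two_le_finrank_mul hV hPc hconv hanti (hdim ▸ hd) hx' hy' (hfinj.ne hxy) hp hq
      (div_nonneg hc0 (by linarith)) hrel
    rw [hdim, mul_div_assoc', le_div_iff₀ (by linarith)] at this
    linarith
  have hlim : ((polytopeVertices P).ncard : ℝ) * (2 / (d + 2)) ^ d ≤ 1 := by
    have htend : Filter.Tendsto (fun c : ℝ => ((polytopeVertices P).ncard : ℝ) * c ^ d)
        (nhdsWithin (2 / (d + 2)) (Set.Iio (2 / (d + 2))))
        (nhds (((polytopeVertices P).ncard : ℝ) * (2 / (d + 2)) ^ d)) :=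
      (Continuous.tendsto (by fun_prop) _).mono_left nhdsWithin_le_nhds
    refine le_of_tendsto htend ?_
    filter_upwards [Ioo_mem_nhdsLT (show (0 : ℝ) < 2 / (d + 2) by positivity)] with c hc
    exact hkey c hc.1.le hc.2
  have hinv : (2 / ((d : ℝ) + 2)) = ((d : ℝ) / 2 + 1)⁻¹ := by
    rw [eq_comm, inv_eq_iff_eq_inv, inv_div]
    ring
  rw [hinv, inv_pow, ← div_eq_mul_inv, div_le_one (by positivity)] at hlim
  exact hlim
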